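/- Let $d\ge 3$ and let $(X,Y)\in\{0,1\}^d\times\{0,1\}$ follow the conditional independence model $p_\theta$ with parameters $\theta=(\{\psi_i\},\{\eta_i\},\pi)$, $\psi_i,\eta_i,\pi\in[0,1]$, that is, $$p_\theta(X=x,Y=y)=p_\theta(Y=y)\prod_{i=1}^d p_\theta(X_i=x_i\mid Y=y),$$ $$\psi_i=\Pr(X_i=1\mid Y=1),\quad \eta_i=\Pr(X_i=0\mid Y=0),\quad \pi=\Pr(Y=1).$$ Assume that under $p_\theta$, for each $i=1,\dots,d$, $X_i$ is not independent of $Y$. Let $x^{(1)},x^{(2)},\dots$ be i.i.d. from the marginal $p_\theta(X)$. A restricted Boltzmann machine (RBM) with $d$ visible units and a single hidden unit has parameters $\lambda=(W,a,b)\in\mathbb R^{d}\times\mathbb R^d\times\mathbb R$ and defines $$p_\lambda(X=x,H=h)=\frac{e^{a^Tx+bh+x^TWh}}{Z},\qquad x\in\{0,1\}^d,\ h\in\{0,1\},$$ where $Z$ is the normalizing constant. A maximum likelihood estimate from $x^{(1)},\dots,x^{(n)}$ is any $\hat\lambda$ that maximizes $\sum_{k=1}^n\log p_\lambda(X=x^{(k)})$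 over all $\lambda$, where $p_\lambda(X=x)=\sum_h p_\lambda(X=x,H=h)$. Then the posterior of a maximum likelihood RBM converges to the true posterior as $n\to\infty$, up to a global label flip: almost surely, for every $\varepsilon>0$ there is $n_0$ such that for every $n\ge n_0$ and every maximum likelihood estimate $\hat\lambda$ from $x^{(1)},\dots,x^{(n)}$ there is a label $y\in\{0,1\}$, the same for all $x$, with $$\bigl|p_{\hat\lambda}(H=1\mid X=x)-p_\theta(Y=y\mid X=x)\bigr|<\varepsilon$$ for every $x\in\{0,1\}^d$ with $p_\theta(X=x)>0$. -/

import Mathlib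

open MeasureTheory ProbabilityTheory Filter

noncomputable section

/-- The vector of real numbers `0` and `1` that a binary configuration stands for. -/
def bits {k : ℕ} (v : Fin k → Bool) : Fin k → ℝ := fun i => if v i then 1 else 0

/-- Parameters `θ = (ψ, η, π)` of the conditional independence model on `d` binary classifiers. -/
structure CondIndParam (d : ℕ) where
  /-- sensitivities `ψ i = Pr(X_i = 1 | Y = 1)` -/
  psi : Fin d → unitInterval
  /-- specificities `η i = Pr(X_i = 0 | Y = 0)` -/
  eta : Fin d → unitInterval
  /-- the label probability `π = Pr(Y = 1)` -/
  pi : unitInterval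

namespace CondIndParam

variable {d : ℕ} (θ : CondIndParam d)

/-- `p_θ(Y = y)` -/
def labelProb (y : Bool) : ℝ := if y then (θ.pi : ℝ) else 1 - (θ.pi : ℝ)

/-- `p_θ(X_i = v | Y = y)` -/
def condProb (i : Fin d) (v y : Bool) : ℝ :=
  match y, v with
  | true, true => (θ.psi i : ℝ)
  | true, false => 1 - (θ.psi i : ℝ)
  | false, false => (θ.eta i : ℝ)
  | false, true => 1 - (θ.eta i : ℝ)

/-- `p_θ(X = x, Y = y) = p_θ(Y = y) ∏ i, p_θ(X_i = x_i | Y = y)` -/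
def joint (x : Fin d → Bool) (y : Bool) : ℝ := θ.labelProb y * ∏ i, θ.condProb i (x i) y

/-- `p_θ(X = x)` -/
def marginal (x : Fin d → Bool) : ℝ := ∑ y, θ.joint x y

/-- `p_θ(Y = y | X = x)`; meaningful where `0 < p_θ(X = x)`. -/
def posterior (x : Fin d → Bool) (y : Bool) : ℝ := θ.joint x y / θ.marginal x

/-- The joint distribution of the pair `(X, Y)`, as a measure. -/
def law : Measure ((Fin d → Bool) × Bool) :=
  ∑ z : (Fin d → Bool) × Bool, ENNReal.ofReal (θ.joint z.1 z.2) • Measure.dirac z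

end CondIndParam

/-- Parameters of a restricted Boltzmann machine with `d` visible and `m` hidden binary units. -/
structure RBM (d m : ℕ) where
  /-- weights -/
  W : Matrix (Fin d) (Fin m) ℝ
  /-- visible biases -/
  a : Fin d → ℝ
  /-- hidden biases -/
  b : Fin m → ℝ

namespace RBM

variable {d m : ℕ} (lam : RBM d m)

/-- `E(x, h) = -(aᵀ x + bᵀ h + xᵀ W h)` -/
def energy (x : Fin d → Bool) (h : Fin m → Bool) : ℝ :=
  -(dotProduct lam.a (bits x) + dotProduct lam.b (bits h) +
    dotProduct (bits x) (lam.W.mulVec (bits h)))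

/-- The partition function `Z`. -/
def partitionFn : ℝ := ∑ x : Fin d → Bool, ∑ h : Fin m → Bool, Real.exp (-lam.energy x h)

/-- `p_λ(X = x, H = h)` -/
def joint (x : Fin d → Bool) (h : Fin m → Bool) : ℝ :=
  Real.exp (-lam.energy x h) / lam.partitionFn

/-- `p_λ(X = x)` -/
def marginal (x : Fin d → Bool) : ℝ := ∑ h : Fin m → Bool, lam.joint x h

/-- `p_λ(H = h | X = x)` -/
def posterior (x : Fin d → Bool) (h : Fin m → Bool) : ℝ := lam.joint x h / lam.marginal x

/-- The log-likelihood of a sample of `n` visible configurations. -/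
def logLikelihood {n : ℕ} (s : Fin n → Fin d → Bool) : ℝ := ∑ k, Real.log (lam.marginal (s k))

/-- `lam` is a maximum likelihood estimate from the sample `s`, among all restricted Boltzmann
machines with `d` visible and `m` hidden units. -/
def IsMLE {n : ℕ} (s : Fin n → Fin d → Bool) : Prop :=
  ∀ lam' : RBM d m, lam'.logLikelihood s ≤ lam.logLikelihood s

end RBM

end

open scoped Topology

/-! ### Moments of the observed bits, and identifiability from `X` alone. -/

namespace CondIndParam

variable {d : ℕ} (θ : CondIndParam d)

/-! An RBM with one hidden unit is a conditional independence model, and every model with parameters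
in the open interval (0, 1) is such an RBM (`RBM.exists_condIndParam`, `RBM.exists_rbm`). RBM
parameters may escape to infinity, for `θ` may lie on the boundary; the argument therefore runs in
the compact cube of triples `(ψ, η, π)`, where joint probabilities are continuous.

Almost surely the empirical frequencies converge to the marginal of `θ`. Any limit point of the
models given by maximum likelihood estimates has the same marginal
(`marginal_eq_of_tendsto_of_forall_le`): RBMs approximate `θ` arbitrarily well, and a Hellinger
bound turns near-optimal likelihood into closeness of marginals.

For `d ≥ 3`, second and third central moments determine the model up to a label flip
(`exists_joint_eq_of_marginal_eq`). Dependence of each `X_i` on `Y` makes these moments informative.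
So every limit point has the posterior of `θ` up to a flip, and compactness excludes a sequence of
bad estimates. -/

lemma labelProb_nonneg (y : Bool) : 0 ≤ θ.labelProb y := by
  cases y
  · simpa [labelProb] using θ.pi.2.2
  · simpa [labelProb] using θ.pi.2.1

lemma condProb_nonneg (i : Fin d) (v y : Bool) : 0 ≤ θ.condProb i v y := by
  cases y <;> cases v <;> simp only [condProb, sub_nonneg]
  exacts [(θ.eta i).2.1, (θ.eta i).2.2, (θ.psi i).2.2, (θ.psi i).2.1]

lemma joint_nonneg (x : Fin d → Bool) (y : Bool) : 0 ≤ θ.joint x y :=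
  mul_nonneg (θ.labelProb_nonneg y) (Finset.prod_nonneg fun i _ => θ.condProb_nonneg i _ y)

lemma marginal_nonneg (x : Fin d → Bool) : 0 ≤ θ.marginal x :=
  Finset.sum_nonneg fun y _ => θ.joint_nonneg x y

lemma sum_joint_mul_prod (f : Fin d → Bool → ℝ) (y : Bool) :
    ∑ x, θ.joint x y * ∏ i, f i (x i) =
      θ.labelProb y * ∏ i, ∑ v, θ.condProb i v y * f i v := by
  rw [Fintype.prod_sum, Finset.mul_sum]
  refine Finset.sum_congr rfl fun x _ => ?_
  rw [joint, mul_assoc, Finset.prod_mul_distrib]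

lemma sum_condProb (i : Fin d) (y : Bool) : ∑ v, θ.condProb i v y = 1 := by
  cases y <;> simp [condProb]

lemma sum_labelProb : ∑ y, θ.labelProb y = 1 := by
  simp [labelProb]

lemma sum_joint (y : Bool) : ∑ x, θ.joint x y = θ.labelProb y := by
  simpa [θ.sum_condProb, -Fintype.univ_bool] using
    θ.sum_joint_mul_prod (fun _ _ => 1) y

lemma sum_marginal : ∑ x, θ.marginal x = 1 := by
  simp only [marginal]
  rw [Finset.sum_comm]
  simp only [sum_joint, sum_labelProb]

/-- Shifted mixed moments of the observed bits split over the hidden label. -/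
lemma sum_marginal_mul_prod (c : Fin d → ℝ) (S : Finset (Fin d)) :
    ∑ x, θ.marginal x * ∏ i ∈ S, (bits x i - c i) =
      ∑ y, θ.labelProb y * ∏ i ∈ S, (θ.condProb i true y - c i) := by
  classical
  simp only [marginal, Finset.sum_mul]
  rw [Finset.sum_comm]
  refine Finset.sum_congr rfl fun y _ => ?_
  have h := θ.sum_joint_mul_prod
    (fun i v => if i ∈ S then (if v then 1 else 0) - c i else 1) y
  simp only [Finset.prod_ite_mem, Finset.univ_inter] at h
  refine h.trans ?_
  congr 1
  rw [← Finset.univ_inter S, ← Finset.prod_ite_mem]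
  refine Finset.prod_congr rfl fun i _ => ?_
  by_cases hi : i ∈ S
  · cases y <;> simp [hi, condProb] <;> ring
  · simpa [hi, -Fintype.univ_bool] using θ.sum_condProb i y

/-- Swapping the names of the two labels. -/
def flip : CondIndParam d where
  psi i := unitInterval.symm (θ.eta i)
  eta i := unitInterval.symm (θ.psi i)
  pi := unitInterval.symm θ.pi

lemma joint_flip (x : Fin d → Bool) (y : Bool) : θ.flip.joint x y = θ.joint x (!y) := by
  have h : ∀ i v, θ.flip.condProb i v y = θ.condProb i v (!y) := by
    intro i v
    cases y <;> cases v <;> simp [flip, condProb]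
  have h' : θ.flip.labelProb y = θ.labelProb (!y) := by
    cases y <;> simp [flip, labelProb]
  simp only [joint, h, h']

lemma marginal_flip (x : Fin d → Bool) : θ.flip.marginal x = θ.marginal x := by
  simp [marginal, joint_flip, add_comm]

/-- The informedness `Pr(X_i = 1 | Y = 1) - Pr(X_i = 1 | Y = 0)`. -/
def effect (i : Fin d) : ℝ := θ.psi i + θ.eta i - 1

lemma effect_flip (i : Fin d) : θ.flip.effect i = -θ.effect i := by
  simp [effect, flip]; ring

/-- `Pr(X_i = 1)` -/
def mean (i : Fin d) : ℝ := 1 - θ.eta i + θ.pi * θ.effect i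

lemma sum_marginal_mul_bits (i : Fin d) : ∑ x, θ.marginal x * bits x i = θ.mean i := by
  have h := θ.sum_marginal_mul_prod 0 {i}
  simp only [Finset.prod_singleton, Pi.zero_apply, sub_zero] at h
  rw [h]
  simp [labelProb, condProb, mean, effect]
  ring

/-- Given the label, a centered bit has mean `(1 - π)` or `-π` times its effect, and the bits are
independent. The scalar factor is thus the central moment of order `S.card` of a Bernoulli(`π`)
variable. -/
lemma sum_marginal_mul_prod_centered (S : Finset (Fin d)) :
    ∑ x, θ.marginal x * ∏ i ∈ S, (bits x i - θ.mean i) =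
      ((θ.pi : ℝ) * (1 - θ.pi) ^ S.card + (1 - θ.pi) * (-θ.pi : ℝ) ^ S.card) *
        ∏ i ∈ S, θ.effect i := by
  rw [sum_marginal_mul_prod]
  have h1 : ∀ i, θ.condProb i true true - θ.mean i = (1 - θ.pi) * θ.effect i := by
    intro i; simp only [condProb, mean, effect]; ring
  have h0 : ∀ i, θ.condProb i true false - θ.mean i = (-θ.pi) * θ.effect i := by
    intro i; simp only [condProb, mean, effect]; ring
  simp only [Fintype.sum_bool, h1, h0, Finset.prod_mul_distrib, Finset.prod_const, labelProb]
  simp only [if_true, Bool.false_eq_true, if_false]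
  ring

variable {θ}

lemma covariance_eq {t : CondIndParam d} (h : t.marginal = θ.marginal) {i j : Fin d}
    (hij : i ≠ j) :
    (t.pi : ℝ) * (1 - t.pi) * (t.effect i * t.effect j) =
      (θ.pi : ℝ) * (1 - θ.pi) * (θ.effect i * θ.effect j) := by
  have hm : t.mean = θ.mean := by
    ext k; rw [← sum_marginal_mul_bits, ← sum_marginal_mul_bits, h]
  have h2 := t.sum_marginal_mul_prod_centered {i, j}
  rw [h, hm, sum_marginal_mul_prod_centered] at h2
  simp only [Finset.prod_pair hij, Finset.card_pair hij] at h2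
  linear_combination -h2

lemma third_moment_eq {t : CondIndParam d} (h : t.marginal = θ.marginal) {i j k : Fin d}
    (hij : i ≠ j) (hik : i ≠ k) (hjk : j ≠ k) :
    (t.pi : ℝ) * (1 - t.pi) * (1 - 2 * t.pi) * (t.effect i * t.effect j * t.effect k) =
      (θ.pi : ℝ) * (1 - θ.pi) * (1 - 2 * θ.pi) * (θ.effect i * θ.effect j * θ.effect k) := by
  have hm : t.mean = θ.mean := by
    ext k; rw [← sum_marginal_mul_bits, ← sum_marginal_mul_bits, h]
  have h2 := t.sum_marginal_mul_prod_centered {i, j, k}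
  rw [h, hm, sum_marginal_mul_prod_centered] at h2
  have hi : i ∉ ({j, k} : Finset (Fin d)) := by simp [hij, hik]
  simp only [Finset.prod_insert hi, Finset.prod_pair hjk, Finset.card_insert_of_notMem hi,
    Finset.card_pair hjk] at h2
  linear_combination -h2

/-- Two mixing weights and effect sizes with the same mixed central moments of orders two and
three agree, once the sign of one effect is fixed. -/
lemma eq_of_moments_eq {p q A B C A' B' C' : ℝ} (hp : p * (1 - p) ≠ 0) (hB : B ≠ 0) (hC : C ≠ 0)
    (hA : 0 < A' * A)
    (hAB : q * (1 - q) * (A' * B') = p * (1 - p) * (A * B))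
    (hAC : q * (1 - q) * (A' * C') = p * (1 - p) * (A * C))
    (hBC : q * (1 - q) * (B' * C') = p * (1 - p) * (B * C))
    (h3 : q * (1 - q) * (1 - 2 * q) * (A' * B' * C') =
      p * (1 - p) * (1 - 2 * p) * (A * B * C)) :
    q = p ∧ A' = A := by
  have hA0 : A ≠ 0 := right_ne_zero_of_mul hA.ne'
  have hA0' : A' ≠ 0 := left_ne_zero_of_mul hA.ne'
  obtain ⟨c, rfl⟩ : ∃ c, A' = c * A := ⟨A' / A, by field_simp⟩
  have hc : 0 < c := by
    by_contra hc
    nlinarith [mul_self_nonneg A]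
  have hs : q * (1 - q) ≠ 0 := by
    intro h0
    rw [h0, zero_mul] at hAB
    exact mul_ne_zero hp (mul_ne_zero hA0 hB) hAB.symm
  -- The ratio AB · AC / BC of covariances isolates the variance of the label times `A ^ 2`.
  have hsq : p * (1 - p) = q * (1 - q) * c ^ 2 := by
    have e : (p * (1 - p)) * (p * (1 - p) * (B * C)) * A ^ 2 =
        (q * (1 - q) * c ^ 2) * (p * (1 - p) * (B * C)) * A ^ 2 := by
      calc _ = (p * (1 - p) * (A * B)) * (p * (1 - p) * (A * C)) := by ring
        _ = (q * (1 - q) * (c * A * B')) * (q * (1 - q) * (c * A * C')) := by rw [hAB, hAC]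
        _ = (q * (1 - q) * c ^ 2) * (q * (1 - q) * (B' * C')) * A ^ 2 := by ring
        _ = _ := by rw [hBC]
    exact mul_right_cancel₀ (mul_ne_zero hp (mul_ne_zero hB hC))
      (mul_right_cancel₀ (pow_ne_zero 2 hA0) e)
  have hB' : B' = c * B := by
    refine mul_left_cancel₀ (mul_ne_zero hs hA0') ?_
    rw [hsq] at hAB
    linear_combination hAB
  have hC' : C' = c * C := by
    refine mul_left_cancel₀ (mul_ne_zero hs hA0') ?_
    rw [hsq] at hAC
    linear_combination hAC
  have ht : 1 - 2 * p = c * (1 - 2 * q) := by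
    refine mul_left_cancel₀ (mul_ne_zero hp (mul_ne_zero (mul_ne_zero hA0 hB) hC)) ?_
    subst hB' hC'
    linear_combination -h3 - c * (1 - 2 * q) * A * B * C * hsq
  -- From `(1 - 2p)² + 4p(1 - p) = 1`, and the same identity for `q`.
  have hc2 : c ^ 2 = 1 := by
    linear_combination (-(1 - 2 * p) - c * (1 - 2 * q)) * ht - 4 * hsq
  have hc1 : c = 1 := by nlinarith
  subst hc1
  exact ⟨by linarith, one_mul A⟩

/-- The sign condition excludes the flipped model. Three coordinates fix `π` and the effect of
coordinate 0, covariances with coordinate 0 fix the other effects, and the means then fix `η` and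
`ψ`. -/
lemma eq_of_marginal_eq_of_effect_pos {t : CondIndParam d} (hd : 3 ≤ d)
    (hpi : (θ.pi : ℝ) * (1 - θ.pi) ≠ 0) (heff : ∀ i, θ.effect i ≠ 0)
    (h : t.marginal = θ.marginal) (hpos : 0 < t.effect ⟨0, by omega⟩ * θ.effect ⟨0, by omega⟩) :
    t = θ := by
  have h01 : (⟨0, by omega⟩ : Fin d) ≠ ⟨1, by omega⟩ := by simp
  have h02 : (⟨0, by omega⟩ : Fin d) ≠ ⟨2, by omega⟩ := by simp
  have h12 : (⟨1, by omega⟩ : Fin d) ≠ ⟨2, by omega⟩ := by simp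
  obtain ⟨hq, h0⟩ := eq_of_moments_eq hpi (heff _) (heff _) hpos (covariance_eq h h01)
    (covariance_eq h h02) (covariance_eq h h12) (third_moment_eq h h01 h02 h12)
  have heq : ∀ i, t.effect i = θ.effect i := by
    intro i
    by_cases hi : (⟨0, by omega⟩ : Fin d) = i
    · rw [← hi, h0]
    · have hc := covariance_eq h hi
      rw [hq, h0] at hc
      exact mul_left_cancel₀ (heff _) (mul_left_cancel₀ hpi hc)
  have hm : ∀ i, t.mean i = θ.mean i := by
    intro i; rw [← sum_marginal_mul_bits, ← sum_marginal_mul_bits, h]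
  have heta : ∀ i, (t.eta i : ℝ) = θ.eta i := by
    intro i
    have := hm i
    rw [mean, mean, heq, hq] at this
    linarith
  have hpsi : ∀ i, (t.psi i : ℝ) = θ.psi i := by
    intro i
    have := heq i
    rw [effect, effect, heta] at this
    linarith
  obtain ⟨p, e, q⟩ := t
  obtain ⟨p', e', q'⟩ := θ
  congr
  · exact funext fun i => Subtype.ext (hpsi i)
  · exact funext fun i => Subtype.ext (heta i)
  · exact Subtype.ext hq

/-- The conditional independence model is identifiable from the distribution of `X`, up to the
names of the labels. -/
theorem exists_joint_eq_of_marginal_eq {t : CondIndParam d} (hd : 3 ≤ d)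
    (hpi : (θ.pi : ℝ) * (1 - θ.pi) ≠ 0) (heff : ∀ i, θ.effect i ≠ 0)
    (h : t.marginal = θ.marginal) : ∃ y, ∀ x, t.joint x true = θ.joint x y := by
  have h01 : (⟨0, by omega⟩ : Fin d) ≠ ⟨1, by omega⟩ := by simp
  have ht : t.effect ⟨0, by omega⟩ ≠ 0 := by
    intro h0
    have hc := covariance_eq h h01
    rw [h0, zero_mul, mul_zero] at hc
    exact mul_ne_zero hpi (mul_ne_zero (heff _) (heff _)) hc.symm
  rcases (mul_ne_zero ht (heff _)).lt_or_gt with hneg | hpos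
  · refine ⟨false, fun x => ?_⟩
    have e := eq_of_marginal_eq_of_effect_pos (t := t.flip) hd hpi heff
      ((funext t.marginal_flip).trans h) (by rw [effect_flip]; linarith)
    rw [← e, joint_flip, Bool.not_false]
  · exact ⟨true, fun x => by rw [eq_of_marginal_eq_of_effect_pos hd hpi heff h hpos]⟩

end CondIndParam

/-! ### The law of `(X, Y)`: independence and empirical frequencies. -/

namespace CondIndParam

variable {d : ℕ} (θ : CondIndParam d)

lemma law_apply (s : Set ((Fin d → Bool) × Bool)) :
    θ.law s = ENNReal.ofReal (∑ z, s.indicator (fun z => θ.joint z.1 z.2) z) := by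
  rw [ENNReal.ofReal_sum_of_nonneg
    (fun z _ => Set.indicator_nonneg (fun z _ => θ.joint_nonneg z.1 z.2) z)]
  simp only [law, Measure.finsetSum_apply, Measure.smul_apply, smul_eq_mul, Measure.dirac_apply]
  refine Finset.sum_congr rfl fun z _ => ?_
  by_cases hz : z ∈ s <;> simp [hz]

lemma law_real_apply (s : Set ((Fin d → Bool) × Bool)) :
    θ.law.real s = ∑ z, s.indicator (fun z => θ.joint z.1 z.2) z := by
  rw [measureReal_def, law_apply, ENNReal.toReal_ofReal]
  exact Finset.sum_nonneg fun z _ =>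
    Set.indicator_nonneg (fun z _ => θ.joint_nonneg z.1 z.2) z

instance : IsProbabilityMeasure θ.law where
  measure_univ := by
    rw [law_apply]
    simp only [Set.indicator_univ, Fintype.sum_prod_type]
    have := θ.sum_marginal
    simp only [marginal] at this
    rw [this, ENNReal.ofReal_one]

lemma map_fst_law_real_singleton (x : Fin d → Bool) :
    (θ.law.map Prod.fst).real {x} = θ.marginal x := by
  rw [map_measureReal_apply measurable_fst (measurableSet_singleton x), law_real_apply,
    Fintype.sum_prod_type, Finset.sum_eq_single x]
  · simp [Set.indicator, marginal]
  · intro x' _ hx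
    simp [Set.indicator, hx]
  · simp

lemma law_real_eval_label (i : Fin d) (v y : Bool) :
    θ.law.real {z | z.1 i = v ∧ z.2 = y} = θ.labelProb y * θ.condProb i v y := by
  rw [law_real_apply, Fintype.sum_prod_type_right, Finset.sum_eq_single y]
  · have h := θ.sum_joint_mul_prod (fun j w => if j = i then (if w = v then 1 else 0) else 1) y
    simp only [Finset.prod_ite_eq', Finset.mem_univ, if_true] at h
    refine Eq.trans (Finset.sum_congr rfl fun x _ => ?_) (h.trans ?_)
    · by_cases hx : x i = v <;> simp [Set.indicator, hx]
    · congr 1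
      rw [Finset.prod_eq_single i]
      · cases v <;> simp
      · intro j _ hj
        simpa [hj, -Fintype.univ_bool] using θ.sum_condProb j y
      · simp
  · intro y' _ hy
    simp [Set.indicator, hy]
  · simp

variable {θ}

/-- Each `Pr(X_i = v, Y = y) - Pr(X_i = v) Pr(Y = y)` is `±π(1 - π)` times the effect. The
contrapositive turns dependence into both nondegeneracy conditions needed for identifiability. -/
lemma indepFun_of_effect_eq_zero {i : Fin d}
    (h : (θ.pi : ℝ) * (1 - θ.pi) * θ.effect i = 0) :
    IndepFun (fun z : (Fin d → Bool) × Bool => z.1 i) (fun z => z.2) θ.law := by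
  have hm : Measurable (fun z : (Fin d → Bool) × Bool => z.1 i) := .of_discrete
  have hm' : Measurable (fun z : (Fin d → Bool) × Bool => z.2) := measurable_snd
  have : IsProbabilityMeasure (θ.law.map fun z => z.1 i) :=
    Measure.isProbabilityMeasure_map hm.aemeasurable
  have : IsProbabilityMeasure (θ.law.map fun z : (Fin d → Bool) × Bool => z.2) :=
    Measure.isProbabilityMeasure_map hm'.aemeasurable
  rw [indepFun_iff_map_prod_eq_prod_map_map hm.aemeasurable hm'.aemeasurable]
  have hpair : Measurable (fun z : (Fin d → Bool) × Bool => (z.1 i, z.2)) := hm.prodMk hm'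
  have : IsProbabilityMeasure (θ.law.map fun z : (Fin d → Bool) × Bool => (z.1 i, z.2)) :=
    Measure.isProbabilityMeasure_map hpair.aemeasurable
  refine ext_iff_measureReal_singleton.2 fun ⟨v, y⟩ => ?_
  have e : ({(v, y)} : Set (Bool × Bool)) = {v} ×ˢ {y} := by simp
  rw [map_measureReal_apply hpair (measurableSet_singleton _), e, measureReal_prod_prod,
    map_measureReal_apply hm (measurableSet_singleton _),
    map_measureReal_apply hm' (measurableSet_singleton _)]
  have e0 : (fun z : (Fin d → Bool) × Bool => (z.1 i, z.2)) ⁻¹' ({v} ×ˢ {y}) =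
      {z | z.1 i = v ∧ z.2 = y} := by ext; simp
  have e1 : θ.law.real ((fun z : (Fin d → Bool) × Bool => z.1 i) ⁻¹' {v}) =
      ∑ y, θ.labelProb y * θ.condProb i v y := by
    simp only [← law_real_eval_label, law_real_apply]
    rw [Finset.sum_comm]
    refine Finset.sum_congr rfl fun ⟨x, b⟩ _ => ?_
    by_cases hx : x i = v <;> cases b <;> simp [Set.indicator, hx]
  have e2 : θ.law.real ((fun z : (Fin d → Bool) × Bool => z.2) ⁻¹' {y}) = θ.labelProb y := by
    rw [← mul_one (θ.labelProb y), ← θ.sum_condProb i y, Finset.mul_sum]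
    simp only [← law_real_eval_label, law_real_apply]
    rw [Finset.sum_comm]
    refine Finset.sum_congr rfl fun ⟨x, b⟩ _ => ?_
    by_cases hx : b = y <;> cases hb : x i <;> simp [Set.indicator, hx, hb]
  rw [e0, e1, e2, law_real_eval_label]
  simp only [effect] at h
  cases v <;> cases y <;> simp [labelProb, condProb] <;> first
    | linear_combination h
    | linear_combination -h

/-- The empirical frequencies of an i.i.d. sample converge to its distribution. -/
lemma ae_tendsto_frequency {α Ω : Type*} [MeasurableSpace α] [Finite α]
    [DiscreteMeasurableSpace α] [DecidableEq α] [MeasurableSpace Ω] {μ : Measure Ω}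
    [IsProbabilityMeasure μ] {P : Measure α} {X : ℕ → Ω → α} (hlaw : ∀ k, HasLaw (X k) P μ)
    (hindep : iIndepFun X μ) :
    ∀ᵐ ω ∂μ, ∀ x, Tendsto
      (fun n : ℕ => (∑ k ∈ Finset.range n, if X k ω = x then (1 : ℝ) else 0) / n) atTop
      (𝓝 (P.real {x})) := by
  rw [ae_all_iff]
  intro x
  have hg : Measurable (fun z : α => if z = x then (1 : ℝ) else 0) := .of_discrete
  have hint : Integrable (fun ω => if X 0 ω = x then (1 : ℝ) else 0) μ := by
    refine Integrable.of_bound (C := 1)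
      (hg.comp_aemeasurable (hlaw 0).aemeasurable).aestronglyMeasurable (ae_of_all _ fun ω => ?_)
    split_ifs <;> simp
  have hslln := strong_law_ae_real (fun k ω => if X k ω = x then (1 : ℝ) else 0) hint
    (fun j k hjk => (hindep.indepFun hjk).comp hg hg)
    (fun k => ((hlaw k).identDistrib (hlaw 0)).comp hg)
  have hE : ∫ ω, (if X 0 ω = x then (1 : ℝ) else 0) ∂μ = P.real {x} := by
    have h1 := (hlaw 0).integral_comp (f := fun z : α => if z = x then (1 : ℝ) else 0)
      hg.aestronglyMeasurable
    refine h1.trans ?_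
    have h2 : (fun z : α => if z = x then (1 : ℝ) else 0) = ({x} : Set α).indicator 1 := by
      ext z; simp [Set.indicator]
    rw [h2, integral_indicator_one (measurableSet_singleton x)]
  rwa [hE] at hslln

end CondIndParam

/-! ### RBMs with one hidden unit as conditional independence models. -/

namespace RBM

variable {d : ℕ}

/-- The unnormalized probability of an RBM with one hidden unit. -/
lemma exp_neg_energy_single (lam : RBM d 1) (x : Fin d → Bool) (y : Bool) :
    Real.exp (-lam.energy x (fun _ => y)) =
      (if y then Real.exp (lam.b 0) else 1) *
        ∏ i, if x i then (if y then Real.exp (lam.a i + lam.W i 0) else Real.exp (lam.a i))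
          else 1 := by
  have h : -lam.energy x (fun _ => y) = (if y then lam.b 0 else 0) +
      ∑ i, if x i then (if y then lam.a i + lam.W i 0 else lam.a i) else 0 := by
    simp only [energy, neg_neg, dotProduct, Matrix.mulVec, bits, Finset.univ_unique,
      Finset.sum_singleton, Fin.default_eq_zero]
    rw [add_right_comm, ← Finset.sum_add_distrib, add_comm]
    congr 1
    · cases y <;> simp
    · refine Finset.sum_congr rfl fun i _ => ?_
      cases y <;> cases x i <;> simp
  rw [h, Real.exp_add, Real.exp_sum]
  congr 1
  · cases y <;> simp
  · refine Finset.prod_congr rfl fun i _ => ?_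
    cases y <;> cases x i <;> simp

lemma sum_hidden (F : (Fin 1 → Bool) → ℝ) : ∑ h, F h = ∑ y : Bool, F (fun _ => y) :=
  Fintype.sum_equiv (Equiv.funUnique (Fin 1) Bool) _ _ fun h =>
    congrArg F (funext fun i => by rw [Subsingleton.elim i 0]; rfl)

/-- An RBM with one hidden unit whose weights are proportional to a conditional independence
model has the same joint distribution. -/
lemma joint_eq_of_proportional {lam : RBM d 1} {θ : CondIndParam d} {C : ℝ}
    (h : ∀ x y, Real.exp (-lam.energy x (fun _ => y)) = C * θ.joint x y)
    (x : Fin d → Bool) (y : Bool) : lam.joint x (fun _ => y) = θ.joint x y := by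
  have hZ : lam.partitionFn = C := by
    simp only [partitionFn, sum_hidden, h, ← Finset.mul_sum]
    have := θ.sum_marginal
    simp only [CondIndParam.marginal] at this
    rw [this, mul_one]
  have hC : C ≠ 0 := by
    rintro rfl
    have := h x y
    rw [zero_mul] at this
    exact (Real.exp_pos _).ne' this
  rw [joint, h, hZ, mul_div_cancel_left₀ _ hC]

lemma marginal_eq_of_joint_eq {lam : RBM d 1} {θ : CondIndParam d}
    (h : ∀ x y, lam.joint x (fun _ => y) = θ.joint x y) (x : Fin d → Bool) :
    lam.marginal x = θ.marginal x := by
  simp only [marginal, sum_hidden, h, CondIndParam.marginal]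

lemma marginal_pos {m : ℕ} (lam : RBM d m) (x : Fin d → Bool) : 0 < lam.marginal x := by
  refine Finset.sum_pos (fun h _ => div_pos (Real.exp_pos _) ?_) Finset.univ_nonempty
  exact Finset.sum_pos (fun x _ => Finset.sum_pos (fun h _ => Real.exp_pos _)
    Finset.univ_nonempty) Finset.univ_nonempty

/-- An RBM with one hidden unit is a conditional independence model. -/
lemma exists_condIndParam (lam : RBM d 1) :
    ∃ θ : CondIndParam d, ∀ x y, lam.joint x (fun _ => y) = θ.joint x y := by
  set u : Fin d → ℝ := fun i => Real.exp (lam.a i + lam.W i 0) with hu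
  set v : Fin d → ℝ := fun i => Real.exp (lam.a i) with hv
  have hu0 : ∀ i, 0 < u i := fun i => Real.exp_pos _
  have hv0 : ∀ i, 0 < v i := fun i => Real.exp_pos _
  -- `A` and `B` are the total unnormalized weights of the hidden states 1 and 0.
  set A : ℝ := Real.exp (lam.b 0) * ∏ i, (1 + u i) with hA
  set B : ℝ := ∏ i, (1 + v i) with hB
  have hP : 0 < ∏ i, (1 + u i) := Finset.prod_pos fun i _ => by linarith [hu0 i]
  have hA0 : 0 < A := mul_pos (Real.exp_pos _) hP
  have hB0 : 0 < B := Finset.prod_pos fun i _ => by linarith [hv0 i]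
  have mem : ∀ {p q : ℝ}, 0 < p → 0 < q → p / (p + q) ∈ unitInterval := fun hp hq =>
    ⟨by positivity, by rw [div_le_one (by positivity)]; linarith⟩
  refine ⟨⟨fun i => ⟨u i / (u i + 1), mem (hu0 i) one_pos⟩,
    fun i => ⟨1 / (1 + v i), mem one_pos (hv0 i)⟩, ⟨A / (A + B), mem hA0 hB0⟩⟩,
    joint_eq_of_proportional (C := A + B) fun x y => ?_⟩
  rw [exp_neg_energy_single, CondIndParam.joint]
  cases y
  · have e : (A + B) * (1 - A / (A + B)) = ∏ i, (1 + v i) := by rw [← hB]; field_simp; ring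
    simp only [CondIndParam.labelProb, Bool.false_eq_true, if_false, one_mul]
    rw [← mul_assoc, e, ← Finset.prod_mul_distrib]
    refine Finset.prod_congr rfl fun i _ => ?_
    have := hv0 i
    cases x i <;> simp [CondIndParam.condProb] <;> field_simp
    ring
  · have e : (A + B) * (A / (A + B)) = Real.exp (lam.b 0) * ∏ i, (1 + u i) := by
      rw [← hA]; field_simp
    simp only [CondIndParam.labelProb, if_true]
    rw [← mul_assoc, e, mul_assoc, ← Finset.prod_mul_distrib]
    congr 1
    refine Finset.prod_congr rfl fun i _ => ?_
    have := hu0 i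
    cases x i <;> simp [CondIndParam.condProb] <;> field_simp <;> ring

/-- A conditional independence model with nondegenerate parameters is an RBM with one hidden
unit. -/
lemma exists_rbm {θ : CondIndParam d} (hpsi : ∀ i, (θ.psi i : ℝ) ∈ Set.Ioo 0 1)
    (heta : ∀ i, (θ.eta i : ℝ) ∈ Set.Ioo 0 1) (hpi : (θ.pi : ℝ) ∈ Set.Ioo 0 1) :
    ∃ lam : RBM d 1, ∀ x y, lam.joint x (fun _ => y) = θ.joint x y := by
  set a : Fin d → ℝ := fun i => Real.log ((1 - θ.eta i) / θ.eta i) with ha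
  set u : Fin d → ℝ := fun i => Real.log (θ.psi i / (1 - θ.psi i)) with hu
  have hpsi0 : ∀ i, (0 : ℝ) < 1 - θ.psi i := fun i => sub_pos.2 (hpsi i).2
  have heta0 : ∀ i, (0 : ℝ) < 1 - θ.eta i := fun i => sub_pos.2 (heta i).2
  have hpi0 : (0 : ℝ) < 1 - θ.pi := sub_pos.2 hpi.2
  have hA : (0 : ℝ) < θ.pi * ∏ i, (1 - θ.psi i : ℝ) :=
    mul_pos hpi.1 (Finset.prod_pos fun i _ => hpsi0 i)
  have hP : (0 : ℝ) < ∏ i, (θ.eta i : ℝ) := Finset.prod_pos fun i _ => (heta i).1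
  have hB : (0 : ℝ) < (1 - θ.pi) * ∏ i, (θ.eta i : ℝ) := mul_pos hpi0 hP
  -- Weights are differences of conditional log-odds. The constant `C` gives the configuration `x =
  -- 0`, `h = 0` its RBM weight `exp 0 = 1`.
  refine ⟨⟨Matrix.of fun i _ => u i - a i, a, fun _ => Real.log
    ((θ.pi * ∏ i, (1 - θ.psi i : ℝ)) / ((1 - θ.pi) * ∏ i, (θ.eta i : ℝ)))⟩,
    joint_eq_of_proportional (C := ((1 - θ.pi) * ∏ i, (θ.eta i : ℝ))⁻¹) fun x y => ?_⟩
  rw [exp_neg_energy_single, CondIndParam.joint]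
  cases y
  · simp only [CondIndParam.labelProb, Bool.false_eq_true, if_false, one_mul]
    rw [mul_inv, ← Finset.prod_inv_distrib, mul_mul_mul_comm, inv_mul_cancel₀ hpi0.ne', one_mul,
      ← Finset.prod_mul_distrib]
    refine Finset.prod_congr rfl fun i _ => ?_
    have h1 := (heta i).1
    have h2 := heta0 i
    cases x i
    · simp [CondIndParam.condProb, h1.ne']
    · simp only [ha, if_true, CondIndParam.condProb]
      rw [Real.exp_log (div_pos h2 h1), div_eq_inv_mul]
  · simp only [CondIndParam.labelProb, if_true, Matrix.of_apply, add_sub_cancel]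
    rw [Real.exp_log (div_pos hA hB), div_eq_inv_mul, mul_assoc, mul_assoc,
      ← Finset.prod_mul_distrib]
    congr 2
    refine Finset.prod_congr rfl fun i _ => ?_
    have h1 := (hpsi i).1
    have h2 := hpsi0 i
    cases x i
    · simp [CondIndParam.condProb]
    · simp only [hu, if_true, CondIndParam.condProb]
      rw [Real.exp_log (div_pos h1 h2), mul_div_cancel₀ _ h2.ne']

end RBM

/-! ### Consistency of the likelihood maximizers. -/

/-- This is `log r ≤ r - 1` at `r = √p / √q`. Unlike the logarithm, the bound stays continuous as
`p` tends to 0; summed over probability vectors it is minus the squared Hellinger distance `∑ (√p -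
√q)²`. -/
lemma mul_log_sub_mul_log_le {p q : ℝ} (hp : 0 < p) (hq : 0 ≤ q) :
    q * Real.log p - q * Real.log q ≤ 2 * (√p * √q - q) := by
  rcases hq.eq_or_lt with rfl | hq
  · simp
  have h1 : Real.log p - Real.log q = 2 * Real.log (√p / √q) := by
    rw [Real.log_div (Real.sqrt_pos.2 hp).ne' (Real.sqrt_pos.2 hq).ne', Real.log_sqrt hp.le,
      Real.log_sqrt hq.le]
    ring
  have h2 : Real.log (√p / √q) ≤ √p / √q - 1 :=
    Real.log_le_sub_one_of_pos (div_pos (Real.sqrt_pos.2 hp) (Real.sqrt_pos.2 hq))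
  have h3 : q * (√p / √q) = √p * √q := by
    have := Real.mul_self_sqrt hq.le
    have := (Real.sqrt_pos.2 hq).ne'
    field_simp
    nlinarith
  calc _ = q * (2 * Real.log (√p / √q)) := by rw [← h1]; ring
    _ ≤ q * (2 * (√p / √q - 1)) := by gcongr
    _ = _ := by rw [← h3]; ring

namespace CondIndParam

variable {d : ℕ}

/-- The conditional independence model as a family over a compact space. -/
def ofTriple (t : (Fin d → unitInterval) × (Fin d → unitInterval) × unitInterval) :
    CondIndParam d := ⟨t.1, t.2.1, t.2.2⟩

lemma continuous_joint_ofTriple (x : Fin d → Bool) (y : Bool) :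
    Continuous fun t => (ofTriple t).joint x y := by
  unfold joint
  refine Continuous.mul ?_ (continuous_finsetProd _ fun i _ => ?_)
  · cases y <;> simp only [labelProb, ofTriple] <;> simp <;> fun_prop
  · cases y <;> cases x i <;> simp only [condProb, ofTriple] <;> fun_prop

lemma continuous_marginal_ofTriple (x : Fin d → Bool) :
    Continuous fun t => (ofTriple t).marginal x :=
  continuous_finsetSum _ fun y _ => continuous_joint_ofTriple x y

/-- The triples of nondegenerate parameters. -/
def nondegenerate (d : ℕ) :
    Set ((Fin d → unitInterval) × (Fin d → unitInterval) × unitInterval) :=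
  (Set.univ.pi fun _ => Set.Ioo 0 1) ×ˢ (Set.univ.pi fun _ => Set.Ioo 0 1) ×ˢ Set.Ioo 0 1

lemma dense_nondegenerate : Dense (nondegenerate d) := by
  have h : Dense (Set.Ioo (0 : unitInterval) 1) := by
    rw [dense_iff_closure_eq, closure_Ioo zero_ne_one]
    ext x
    exact ⟨fun _ => trivial, fun _ => ⟨unitInterval.nonneg', unitInterval.le_one'⟩⟩
  have hp : Dense (Set.univ.pi fun _ : Fin d => Set.Ioo (0 : unitInterval) 1) :=
    dense_pi _ fun _ _ => h
  exact hp.prod (hp.prod h)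

lemma exists_rbm_of_mem_nondegenerate
    {t : (Fin d → unitInterval) × (Fin d → unitInterval) × unitInterval}
    (ht : t ∈ nondegenerate d) :
    ∃ lam : RBM d 1, ∀ x, lam.marginal x = (ofTriple t).marginal x := by
  obtain ⟨h1, h2, h3⟩ := ht
  have key : ∀ {p : unitInterval}, p ∈ Set.Ioo 0 1 → (p : ℝ) ∈ Set.Ioo 0 1 := fun h => ⟨h.1, h.2⟩
  obtain ⟨lam, h⟩ := RBM.exists_rbm (θ := ofTriple t) (fun i => key (h1 i trivial))
    (fun i => key (h2 i trivial)) (key h3)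
  exact ⟨lam, RBM.marginal_eq_of_joint_eq h⟩

/-- If the empirical frequencies `f` converge to a conditional independence model, so do the
likelihood maximizers. -/
theorem marginal_eq_of_tendsto_of_forall_le {ι : Type*} {l : Filter ι} [l.NeBot]
    {θ t : CondIndParam d} {f p : ι → (Fin d → Bool) → ℝ} (hf0 : ∀ n x, 0 ≤ f n x)
    (hp0 : ∀ n x, 0 < p n x)
    (hf : ∀ x, Tendsto (fun n => f n x) l (𝓝 (θ.marginal x)))
    (hp : ∀ x, Tendsto (fun n => p n x) l (𝓝 (t.marginal x)))
    (hmle : ∀ lam : RBM d 1, ∀ᶠ n in l,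
      ∑ x, f n x * Real.log (lam.marginal x) ≤ ∑ x, f n x * Real.log (p n x)) :
    t.marginal = θ.marginal := by
  -- Each fixed competitor is compared with the maximizers before passing to the limit; continuity
  -- of `x log x` at 0 covers configurations of zero probability.
  have hlim : ∀ lam : RBM d 1,
      ∑ x, (θ.marginal x * Real.log (lam.marginal x) -
          θ.marginal x * Real.log (θ.marginal x)) ≤
        ∑ x, 2 * (√(t.marginal x) * √(θ.marginal x) - θ.marginal x) := by
    intro lam
    refine le_of_tendsto_of_tendsto
      (tendsto_finsetSum _ fun x _ => ((hf x).mul_const _).sub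
        ((Real.continuous_mul_log.tendsto _).comp (hf x)))
      (tendsto_finsetSum _ fun x _ => (((hp x).sqrt.mul (hf x).sqrt).sub (hf x)).const_mul 2)
      ((hmle lam).mono fun n hn => ?_)
    calc _ ≤ ∑ x, (f n x * Real.log (p n x) - f n x * Real.log (f n x)) := by
          simp only [Finset.sum_sub_distrib, Function.comp_apply]
          linarith
      _ ≤ _ := Finset.sum_le_sum fun x _ => mul_log_sub_mul_log_le (hp0 n x) (hf0 n x)
  -- Competitors now approach `θ` from nondegenerate parameters, so the left side of `hlim` tends to
  -- 0. Where `θ.marginal x = 0` the logarithm may diverge, but its coefficient vanishes.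
  have hzero : 0 ≤ ∑ x, 2 * (√(t.marginal x) * √(θ.marginal x) - θ.marginal x) := by
    set T : (Fin d → unitInterval) × (Fin d → unitInterval) × unitInterval :=
      (θ.psi, θ.eta, θ.pi) with hT
    have : (𝓝[nondegenerate d] T).NeBot :=
      mem_closure_iff_nhdsWithin_neBot.1 (dense_nondegenerate T)
    have hmarg : ∀ x, Tendsto (fun s => (ofTriple s).marginal x) (𝓝[nondegenerate d] T)
        (𝓝 (θ.marginal x)) := fun x =>
      ((continuous_marginal_ofTriple x).tendsto T).mono_left nhdsWithin_le_nhds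
    have hterm : ∀ x, Tendsto (fun s => θ.marginal x * Real.log ((ofTriple s).marginal x) -
          θ.marginal x * Real.log (θ.marginal x)) (𝓝[nondegenerate d] T) (𝓝 0) := by
      intro x
      rcases (θ.marginal_nonneg x).eq_or_lt with h0 | h0
      · simp [← h0]
      · have := (((hmarg x).log h0.ne').const_mul (θ.marginal x)).sub_const
          (θ.marginal x * Real.log (θ.marginal x))
        rwa [sub_self] at this
    have hsum := tendsto_finsetSum Finset.univ fun x _ => hterm x
    rw [Finset.sum_const_zero] at hsum
    refine le_of_tendsto hsum (eventually_mem_nhdsWithin.mono fun s hs => ?_)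
    obtain ⟨lam, h⟩ := exists_rbm_of_mem_nondegenerate hs
    simpa only [h] using hlim lam
  have hsq : ∑ x, (√(t.marginal x) - √(θ.marginal x)) ^ 2 =
      -∑ x, 2 * (√(t.marginal x) * √(θ.marginal x) - θ.marginal x) := by
    have e : ∀ x, (√(t.marginal x) - √(θ.marginal x)) ^ 2 =
        (t.marginal x - θ.marginal x) -
          2 * (√(t.marginal x) * √(θ.marginal x) - θ.marginal x) := by
      intro x
      have h1 := Real.sq_sqrt (t.marginal_nonneg x)
      have h2 := Real.sq_sqrt (θ.marginal_nonneg x)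
      linear_combination h1 + h2
    simp only [e]
    rw [Finset.sum_sub_distrib, Finset.sum_sub_distrib, sum_marginal, sum_marginal]
    ring
  have hall := (Finset.sum_eq_zero_iff_of_nonneg (fun x _ => sq_nonneg _)).1
    (le_antisymm (hsq.trans_le (by linarith)) (Finset.sum_nonneg fun x _ => sq_nonneg _))
  ext x
  have := sub_eq_zero.1 (pow_eq_zero_iff two_ne_zero |>.1 (hall x (Finset.mem_univ x)))
  exact (Real.sqrt_inj (t.marginal_nonneg x) (θ.marginal_nonneg x)).1 this

end CondIndParam

/-! ### Convergence of the posterior. -/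

/-- The likelihood depends on the sample only through its frequencies. For `n = 0` both sides are 0,
since division by zero gives 0. -/
lemma RBM.logLikelihood_div {d m n : ℕ} (lam : RBM d m) (s : ℕ → Fin d → Bool) :
    lam.logLikelihood (fun k : Fin n => s k) / n =
      ∑ x, (∑ k ∈ Finset.range n, if s k = x then (1 : ℝ) else 0) / n *
        Real.log (lam.marginal x) := by
  simp only [logLikelihood, div_mul_eq_mul_div]
  rw [← Finset.sum_div, Fin.sum_univ_eq_sum_range (fun k => Real.log (lam.marginal (s k)))]
  congr 1
  simp only [Finset.sum_mul]
  rw [Finset.sum_comm]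
  simp

theorem lemma2 {d : ℕ} (hd : 3 ≤ d) (θ : CondIndParam d)
    (hdep : ∀ i : Fin d,
      ¬ IndepFun (fun z : (Fin d → Bool) × Bool => z.1 i) (fun z => z.2) θ.law)
    {Ω : Type*} [MeasurableSpace Ω] (μ : Measure Ω) [IsProbabilityMeasure μ]
    (X : ℕ → Ω → (Fin d → Bool))
    (hlaw : ∀ k, HasLaw (X k) (θ.law.map Prod.fst) μ)
    (hindep : iIndepFun X μ) :
    ∀ᵐ ω ∂μ, ∀ ε : ℝ, 0 < ε → ∀ᶠ n : ℕ in atTop,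
      ∀ lam : RBM d 1, lam.IsMLE (fun k : Fin n => X k ω) →
        ∃ y : Bool, ∀ x : Fin d → Bool, 0 < θ.marginal x →
          |lam.posterior x (fun _ => true) - θ.posterior x y| < ε := by
  have hne : ∀ i, (θ.pi : ℝ) * (1 - θ.pi) * θ.effect i ≠ 0 := fun i h =>
    hdep i (CondIndParam.indepFun_of_effect_eq_zero h)
  have hpi : (θ.pi : ℝ) * (1 - θ.pi) ≠ 0 := left_ne_zero_of_mul (hne ⟨0, by omega⟩)
  have heff : ∀ i, θ.effect i ≠ 0 := fun i => right_ne_zero_of_mul (hne i)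
  filter_upwards [CondIndParam.ae_tendsto_frequency hlaw hindep] with ω hω ε hε
  simp only [CondIndParam.map_fst_law_real_singleton] at hω
  by_contra hbad
  rw [not_eventually] at hbad
  push Not at hbad
  set P : ℕ → RBM d 1 → Prop := fun n lam => lam.IsMLE (fun k : Fin n => X k ω) ∧
    ∀ y, ∃ x, 0 < θ.marginal x ∧ ε ≤ |lam.posterior x (fun _ => true) - θ.posterior x y| with hP
  have hfreq : ∃ᶠ n in atTop, ∃ lam, P n lam := hbad
  have : ∀ n, ∃ lam : RBM d 1, (∃ lam, P n lam) → P n lam := by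
    intro n
    by_cases h : ∃ lam, P n lam
    · exact ⟨h.choose, fun _ => h.choose_spec⟩
    -- An arbitrary value at indices without a bad estimate; the ultrafilter below ignores them.
    · exact ⟨⟨0, 0, 0⟩, fun h' => absurd h' h⟩
  choose lam hlam using this
  choose p hp using fun n => (lam n).exists_condIndParam
  have : (atTop ⊓ 𝓟 {n | ∃ lam, P n lam}).NeBot := frequently_mem_iff_neBot.1 hfreq
  -- An ultrafilter on the bad indices, finer than `atTop`, replaces a convergent subsequence: by
  -- compactness the parameters converge along it.
  obtain ⟨U, hUle⟩ := Ultrafilter.exists_le (atTop ⊓ 𝓟 {n | ∃ lam, P n lam})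
  have hUtop : (U : Filter ℕ) ≤ atTop := hUle.trans inf_le_left
  have hUP : ∀ᶠ n in U, P n (lam n) := by
    have : {n | ∃ lam, P n lam} ∈ (U : Filter ℕ) :=
      hUle (mem_inf_of_right (mem_principal_self _))
    filter_upwards [this] with n hn using hlam n hn
  set g : ℕ → (Fin d → unitInterval) × (Fin d → unitInterval) × unitInterval :=
    fun n => ((p n).psi, (p n).eta, (p n).pi) with hg
  obtain ⟨T, hgT⟩ : ∃ T, Tendsto g U (𝓝 T) := ⟨_, (U.map g).le_nhds_lim⟩
  have hgp : ∀ n, CondIndParam.ofTriple (g n) = p n := fun n => rfl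
  have hjoint : ∀ x y, Tendsto (fun n => (lam n).joint x (fun _ => y)) U
      (𝓝 ((CondIndParam.ofTriple T).joint x y)) := fun x y =>
    (((CondIndParam.continuous_joint_ofTriple x y).tendsto T).comp hgT).congr fun n => by
      rw [Function.comp_apply, hgp, hp]
  have hmarg : ∀ x, Tendsto (fun n => (lam n).marginal x) U
      (𝓝 ((CondIndParam.ofTriple T).marginal x)) := fun x =>
    (((CondIndParam.continuous_marginal_ofTriple x).tendsto T).comp hgT).congr fun n => by
      rw [Function.comp_apply, hgp, RBM.marginal_eq_of_joint_eq (hp n)]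
  have heq : (CondIndParam.ofTriple T).marginal = θ.marginal := by
    refine CondIndParam.marginal_eq_of_tendsto_of_forall_le (l := (U : Filter ℕ))
      (f := fun n x => (∑ k ∈ Finset.range n, if X k ω = x then (1 : ℝ) else 0) / n)
      (fun n x => div_nonneg (Finset.sum_nonneg fun k _ => by split_ifs <;> simp)
        n.cast_nonneg)
      (fun n x => (lam n).marginal_pos x) (fun x => (hω x).mono_left hUtop) hmarg
      fun lam' => hUP.mono fun n hn => ?_
    rw [← RBM.logLikelihood_div lam' (fun k => X k ω),
      ← RBM.logLikelihood_div (lam n) (fun k => X k ω)]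
    exact div_le_div_of_nonneg_right (hn.1 lam') n.cast_nonneg
  obtain ⟨y, hy⟩ := CondIndParam.exists_joint_eq_of_marginal_eq hd hpi heff heq
  have hpost : ∀ᶠ n in (U : Filter ℕ), ∀ x, 0 < θ.marginal x →
      |(lam n).posterior x (fun _ => true) - θ.posterior x y| < ε := by
    refine eventually_all.2 fun x => ?_
    by_cases hx : 0 < θ.marginal x
    -- Only joint and marginal limits are needed, as the limiting denominator is positive.
    · have h1 := (hjoint x true).div (hmarg x) (by rw [heq]; exact hx.ne')
      rw [hy, heq] at h1
      filter_upwards [Metric.tendsto_nhds.1 h1 ε hε] with n hn _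
      rwa [Real.dist_eq] at hn
    · exact Eventually.of_forall fun n h => absurd h hx
  obtain ⟨n, hn, hn'⟩ := (hUP.and hpost).exists
  obtain ⟨x, hx, hle⟩ := hn.2 y
  exact (hn' x hx).not_ge hle
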